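/- Let $M=(|M|,\mathcal O_M)$ be a supermanifold of dimension $m|n$, i.e. a second countable Hausdorff space with a sheaf of supercommutative $\mathbb Z_2$-graded real algebras (with local stalks) that is locally isomorphic to $(U, C^\infty_U\otimes\bigwedge\mathbb R^n)$, $U\subset\mathbb R^m$ open. Let $\mathrm{Vect}(M)$ be the left $\mathcal O_M(|M|)$-module of superderivations of $\mathcal O_M(|M|)$, with the supercommutator $[X,Y]=XY-(-1)^{|X||Y|}YX$; here and below $|\cdot|\in\mathbb Z_2$ is the parity, and formulas with signs are for homogeneous elements and are extended additively. Let $g$ be a Riemannian metric on $M$: a morphism of sheaves $\mathcal TM\otimes\mathcal TM\to\mathcal O_M$ that is homogeneous of some parity $|g|\in\mathbb Z_2$ (so $|g(X,Y)|=|X|+|Y|+|g|$), $\mathcal O_M$-linear ($g(fX,Y)=f\,g(X,Y)$), graded symmetric ($g(X,Y)=(-1)^{|X||Y|}g(Y,X)$) and non-degenerate (if $g(X,Y)=0$ for all $Y$, then $X=0$). An affine connection is a parity-preserving biadditive map $(X,Y)\mapsto\nabla_XY$ on $\mathrm{Vect}(M)$ with $\nabla_{fX}Y=f\nabla_XY$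 and $\nabla_X(fY)=X(f)Y+(-1)^{|X||f|}f\nabla_XY$; its curvature is $$R_\nabla(X,Y)Z=\nabla_X\nabla_YZ-(-1)^{|X||Y|}\nabla_Y\nabla_XZ-\nabla_{[X,Y]}Z .$$ Let $\nabla^L$ be the Levi-Civita connection of $g$, i.e. the affine connection with $\nabla^L_XY-(-1)^{|X||Y|}\nabla^L_YX=[X,Y]$ and $X\,g(Y,Z)=g(\nabla^L_XY,Z)+(-1)^{|X||Y|}g(Y,\nabla^L_XZ)$, and let $R^L$ be its curvature. Let $P\in\mathrm{Vect}(M)$ be homogeneous with $|g|+|P|=0$, put $\pi(Z)=g(Z,P)$, and let $\widehat\nabla$ be the semi-symmetric non-metric connection $$\widehat\nabla_XY=\nabla^L_XY+(-1)^{|X||Y|}g(Y,P)X .$$ Then $\pi$ is an even one-form, i.e. $|\pi(Z)|=|Z|$, and for all homogeneous $X,Y,Z\in\mathrm{Vect}(M)$ $$\begin{aligned}R_{\widehat\nabla}(X,Y)Z={}&R^L(X,Y)Z+(-1)^{(|X|+|Y|)|Z|}\bigl[g(Z,\nabla^L_XP)Y-(-1)^{|X||Y|}g(Z,\nabla^L_YP)X\bigr]\\&+(-1)^{(|X|+|Y|)|Z|}\pi(Z)\bigl[(-1)^{|X||Y|}\pi(Y)X-\pi(X)Y\bigr].\end{aligned}$$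 -/

import Mathlib

open CategoryTheory TopologicalSpace Opposite
open scoped Manifold ContDiff TensorProduct

noncomputable section

/-! ### Superalgebras and their derivations -/

/-- The sign `(-1)^i` of a parity `i`. -/
def paritySign (i : ZMod 2) : ℤ := (-1) ^ i.val

theorem paritySign_aux : ∀ i j k : ZMod 2,
    paritySign (i * k) * paritySign (j * k) = paritySign ((j + i) * k) := by
  decide

/-- `ab = (-1)^{|a||b|} ba` for homogeneous `a`, `b`. -/
class SuperCommutative {A : Type*} [Ring A] [Algebra ℝ A] (𝒜 : ZMod 2 → Submodule ℝ A) : Prop where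
  comm : ∀ {i j : ZMod 2} {a b : A}, a ∈ 𝒜 i → b ∈ 𝒜 j → a * b = paritySign (i * j) • (b * a)

section Superalgebra

variable {A : Type*} [Ring A] [Algebra ℝ A] (𝒜 : ZMod 2 → Submodule ℝ A)

/-- Superderivations of degree `i`:
`D(ab) = D(a)b + (-1)^{i|a|} a D(b)` and `|D(a)| = i + |a|`. -/
def superDer (i : ZMod 2) : Submodule ℝ (Module.End ℝ A) where
  carrier := {D | (∀ j, ∀ a ∈ 𝒜 j, D a ∈ 𝒜 (i + j)) ∧
    ∀ j, ∀ a ∈ 𝒜 j, ∀ b, D (a * b) = D a * b + paritySign (i * j) • (a * D b)}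
  add_mem' := by
    rintro D E ⟨hD, hD'⟩ ⟨hE, hE'⟩
    refine ⟨fun j a ha => (𝒜 _).add_mem (hD j a ha) (hE j a ha), fun j a ha b => ?_⟩
    simp only [LinearMap.add_apply, hD' j a ha b, hE' j a ha b, add_mul, mul_add, smul_add]
    abel
  zero_mem' := ⟨fun j a _ => by simp, fun j a _ b => by simp⟩
  smul_mem' := by
    rintro c D ⟨hD, hD'⟩
    refine ⟨fun j a ha => (𝒜 _).smul_mem c (hD j a ha), fun j a ha b => ?_⟩
    simp only [LinearMap.smul_apply, hD' j a ha b, smul_add, smul_mul_assoc, mul_smul_comm,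
      smul_comm c]

variable {𝒜} in
theorem superBracket_mem {i j : ZMod 2} {D E : Module.End ℝ A} (hD : D ∈ superDer 𝒜 i)
    (hE : E ∈ superDer 𝒜 j) : D * E - paritySign (i * j) • (E * D) ∈ superDer 𝒜 (i + j) := by
  refine ⟨fun k a ha => ?_, fun k a ha b => ?_⟩
  · refine (𝒜 _).sub_mem ?_ ?_
    · have := hD.1 _ _ (hE.1 k a ha); rwa [← add_assoc] at this
    · have := hE.1 _ _ (hD.1 k a ha)
      rw [← add_assoc, add_comm j] at this
      exact zsmul_mem this _
  · simp only [LinearMap.sub_apply, LinearMap.smul_apply, Module.End.mul_apply, hD.2 k a ha,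
      hE.2 k a ha, map_add, map_zsmul, hD.2 _ _ (hE.1 k a ha), hE.2 _ _ (hD.1 k a ha)]
    generalize D a * E b = p
    generalize E a * D b = q
    rw [sub_mul, mul_sub, smul_mul_assoc, mul_smul_comm]
    have : ∀ i : ZMod 2, i = 0 ∨ i = 1 := by decide
    have h1 : (1 + 1 : ZMod 2) = 0 := by decide
    have h2 : paritySign 0 = 1 := by decide
    have h3 : paritySign 1 = -1 := by decide
    rcases this i with rfl | rfl <;> rcases this j with rfl | rfl <;>
      rcases this k with rfl | rfl <;> simp [h1, h2, h3] <;> abel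

variable [GradedAlgebra 𝒜]

/-- The component of degree `i` of a linear endomorphism of a superalgebra. -/
def homPart (i : ZMod 2) : Module.End ℝ A →ₗ[ℝ] Module.End ℝ A where
  toFun D := ∑ j : ZMod 2, GradedAlgebra.proj 𝒜 (i + j) ∘ₗ D ∘ₗ GradedAlgebra.proj 𝒜 j
  map_add' D E := by
    simp only [LinearMap.add_comp, LinearMap.comp_add, Finset.sum_add_distrib]
  map_smul' c D := by
    simp only [LinearMap.smul_comp, LinearMap.comp_smul, Finset.smul_sum, RingHom.id_apply]

variable {𝒜}

theorem proj_of_mem {i : ZMod 2} {a : A} (ha : a ∈ 𝒜 i) (j : ZMod 2) :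
    GradedAlgebra.proj 𝒜 j a = if i = j then a else 0 := by
  rw [GradedAlgebra.proj_apply]
  split_ifs with h
  · subst h; exact DirectSum.decompose_of_mem_same 𝒜 ha
  · exact DirectSum.decompose_of_mem_ne 𝒜 ha h

theorem proj_mem (i : ZMod 2) (a : A) : GradedAlgebra.proj 𝒜 i a ∈ 𝒜 i := by
  rw [GradedAlgebra.proj_apply]; exact SetLike.coe_mem _

theorem sum_proj (a : A) : ∑ i : ZMod 2, GradedAlgebra.proj 𝒜 i a = a := by
  classical
  conv_rhs => rw [← DirectSum.sum_support_decompose 𝒜 a]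
  symm
  refine Finset.sum_subset (Finset.subset_univ _) fun i _ hi => ?_
  simpa using hi

theorem end_ext_hom {D E : Module.End ℝ A} (h : ∀ j, ∀ a ∈ 𝒜 j, D a = E a) : D = E := by
  ext a
  rw [← sum_proj (𝒜 := 𝒜) a, map_sum, map_sum]
  exact Finset.sum_congr rfl fun i _ => h i _ (proj_mem i a)

theorem homPart_apply (i : ZMod 2) (D : Module.End ℝ A) {j : ZMod 2} {a : A} (ha : a ∈ 𝒜 j) :
    homPart 𝒜 i D a = GradedAlgebra.proj 𝒜 (i + j) (D a) := by
  simp only [homPart, LinearMap.coe_mk, AddHom.coe_mk, LinearMap.sum_apply, LinearMap.comp_apply,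
    proj_of_mem ha]
  rw [Finset.sum_eq_single j]
  · simp
  · intro k _ hk; simp [Ne.symm hk]
  · simp

theorem sum_homPart (D : Module.End ℝ A) : ∑ i, homPart 𝒜 i D = D := by
  refine end_ext_hom (𝒜 := 𝒜) fun j a ha => ?_
  simp only [LinearMap.sum_apply, homPart_apply _ _ ha]
  conv_rhs => rw [← sum_proj (𝒜 := 𝒜) (D a)]
  exact Fintype.sum_equiv (Equiv.addRight j) _ _ fun i => rfl

theorem homPart_of_mem {i : ZMod 2} {D : Module.End ℝ A} (hD : D ∈ superDer 𝒜 i) (j : ZMod 2) :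
    homPart 𝒜 j D = if i = j then D else 0 := by
  refine end_ext_hom (𝒜 := 𝒜) fun k a ha => ?_
  rw [homPart_apply _ _ ha, proj_of_mem (hD.1 k a ha)]
  by_cases h : i = j <;> simp [h]

theorem smul_mem_superDer [SuperCommutative 𝒜] {i j : ZMod 2} {f : A} (hf : f ∈ 𝒜 j)
    {D : Module.End ℝ A} (hD : D ∈ superDer 𝒜 i) : f • D ∈ superDer 𝒜 (j + i) := by
  refine ⟨fun k a ha => ?_, fun k a ha b => ?_⟩
  · rw [add_assoc]; exact SetLike.mul_mem_graded hf (hD.1 k a ha)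
  · simp only [LinearMap.smul_apply, smul_eq_mul, hD.2 k a ha b, mul_add, mul_assoc, mul_smul_comm]
    congr 1
    rw [← mul_assoc, SuperCommutative.comm hf ha, ← mul_assoc, smul_mul_assoc, smul_smul]
    congr 1
    exact paritySign_aux i j k

theorem homPart_smul {j : ZMod 2} {f : A} (hf : f ∈ 𝒜 j) (i : ZMod 2) (D : Module.End ℝ A) :
    homPart 𝒜 (j + i) (f • D) = f • homPart 𝒜 i D := by
  refine end_ext_hom (𝒜 := 𝒜) fun k a ha => ?_
  rw [homPart_apply _ _ ha, LinearMap.smul_apply, LinearMap.smul_apply, homPart_apply _ _ ha,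
    smul_eq_mul, smul_eq_mul, add_assoc, GradedAlgebra.proj_apply, GradedAlgebra.proj_apply]
  exact DirectSum.coe_decompose_mul_add_of_left_mem 𝒜 hf

variable (𝒜)

/-- The left `A`-module `Der(A)` of superderivations of a supercommutative algebra: the linear
endomorphisms whose homogeneous components are superderivations. -/
def superDerModule [SuperCommutative 𝒜] : Submodule A (Module.End ℝ A) where
  carrier := {D | ∀ i, homPart 𝒜 i D ∈ superDer 𝒜 i}
  add_mem' := by
    intro D E hD hE i
    rw [map_add]; exact (superDer 𝒜 i).add_mem (hD i) (hE i)
  zero_mem' := by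
    intro i; rw [map_zero]; exact (superDer 𝒜 i).zero_mem
  smul_mem' := by
    intro f D hD i
    rw [← sum_proj (𝒜 := 𝒜) f, Finset.sum_smul, map_sum]
    refine Submodule.sum_mem _ fun j _ => ?_
    have h := smul_mem_superDer (proj_mem (𝒜 := 𝒜) j f) (hD (i - j))
    rw [← homPart_smul (proj_mem j f), add_sub_cancel] at h
    exact h

/-- The type of superderivations. -/
def SuperDer [SuperCommutative 𝒜] : Type _ := superDerModule 𝒜

instance [SuperCommutative 𝒜] : AddCommGroup (SuperDer 𝒜) :=
  inferInstanceAs (AddCommGroup (superDerModule 𝒜))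

instance [SuperCommutative 𝒜] : Module A (SuperDer 𝒜) :=
  inferInstanceAs (Module A (superDerModule 𝒜))

variable {𝒜} in
/-- A superderivation as a linear endomorphism. -/
def SuperDer.toEnd [SuperCommutative 𝒜] : SuperDer 𝒜 →ₗ[A] Module.End ℝ A :=
  (superDerModule 𝒜).subtype

variable {𝒜} in
theorem SuperDer.ext_toEnd [SuperCommutative 𝒜] {X Y : SuperDer 𝒜} (h : X.toEnd = Y.toEnd) :
    X = Y :=
  Subtype.ext h

variable {𝒜} [SuperCommutative 𝒜]

theorem mem_superDerModule {i : ZMod 2} {D : Module.End ℝ A} (hD : D ∈ superDer 𝒜 i) :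
    D ∈ superDerModule 𝒜 := by
  intro j
  rw [homPart_of_mem hD]
  split_ifs with h
  · exact h ▸ hD
  · exact (superDer 𝒜 j).zero_mem

namespace SuperDer

/-- `X` is homogeneous of parity `i`. (The zero derivation has both parities.) -/
def HasParity (X : SuperDer 𝒜) (i : ZMod 2) : Prop := X.toEnd ∈ superDer 𝒜 i

/-- The homogeneous component of parity `i`. -/
def part (i : ZMod 2) (X : SuperDer 𝒜) : SuperDer 𝒜 :=
  ⟨homPart 𝒜 i X.toEnd, mem_superDerModule (X.2 i)⟩

/-- The supercommutator, `[X, Y] = XY - (-1)^{|X||Y|} YX` for homogeneous `X`, `Y`,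
extended biadditively. -/
def bracket (X Y : SuperDer 𝒜) : SuperDer 𝒜 :=
  ∑ i : ZMod 2, ∑ j : ZMod 2,
    ⟨(part i X).toEnd * (part j Y).toEnd -
      paritySign (i * j) • ((part j Y).toEnd * (part i X).toEnd),
      mem_superDerModule (superBracket_mem (X.2 i) (Y.2 j))⟩

/-- The right multiplication, `X · f = (-1)^{|X||f|} f X` for homogeneous `X`, `f`,
extended biadditively. -/
def rightMul (X : SuperDer 𝒜) (f : A) : SuperDer 𝒜 :=
  ∑ i : ZMod 2, ∑ j : ZMod 2, paritySign (i * j) • (GradedAlgebra.proj 𝒜 j f • part i X)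

theorem part_of_hasParity {X : SuperDer 𝒜} {i : ZMod 2} (hX : X.HasParity i) (j : ZMod 2) :
    part j X = if i = j then X else 0 := by
  apply ext_toEnd
  change homPart 𝒜 j X.toEnd = _
  rw [homPart_of_mem hX]
  split_ifs <;> rfl

theorem sum_part (X : SuperDer 𝒜) : ∑ i, part i X = X := by
  apply ext_toEnd
  rw [map_sum]
  exact sum_homPart (𝒜 := 𝒜) X.toEnd

theorem part_add (i : ZMod 2) (X Y : SuperDer 𝒜) : part i (X + Y) = part i X + part i Y :=
  ext_toEnd (map_add (homPart 𝒜 i) _ _)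

theorem rightMul_add_left (X Y : SuperDer 𝒜) (f : A) :
    rightMul (X + Y) f = rightMul X f + rightMul Y f := by
  simp only [rightMul, part_add, smul_add, Finset.sum_add_distrib]

theorem rightMul_add_right (X : SuperDer 𝒜) (f h : A) :
    rightMul X (f + h) = rightMul X f + rightMul X h := by
  simp only [rightMul, map_add, add_smul, smul_add, Finset.sum_add_distrib]

theorem rightMul_of_hasParity {X : SuperDer 𝒜} {i j : ZMod 2} {f : A} (hX : X.HasParity i)
    (hf : f ∈ 𝒜 j) : rightMul X f = paritySign (i * j) • (f • X) := by
  unfold rightMul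
  rw [Finset.sum_eq_single i, Finset.sum_eq_single j]
  · rw [part_of_hasParity hX, if_pos rfl, proj_of_mem hf, if_pos rfl]
  · intro k _ hk
    rw [proj_of_mem hf, if_neg (Ne.symm hk), zero_smul, smul_zero]
  · exact fun h => absurd (Finset.mem_univ _) h
  · intro k _ hk
    refine Finset.sum_eq_zero fun l _ => ?_
    rw [part_of_hasParity hX, if_neg (Ne.symm hk), smul_zero, smul_zero]
  · exact fun h => absurd (Finset.mem_univ _) h

theorem HasParity.smul {X : SuperDer 𝒜} {i j : ZMod 2} {f : A} (hf : f ∈ 𝒜 j)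
    (hX : X.HasParity i) : (f • X).HasParity (j + i) :=
  smul_mem_superDer hf hX

theorem hasParity_part (X : SuperDer 𝒜) (i : ZMod 2) : (part i X).HasParity i := X.2 i

theorem HasParity.add {X Y : SuperDer 𝒜} {i : ZMod 2} (hX : X.HasParity i)
    (hY : Y.HasParity i) : (X + Y).HasParity i :=
  (superDer 𝒜 i).add_mem hX hY

theorem HasParity.zsmul {X : SuperDer 𝒜} {i : ZMod 2} (hX : X.HasParity i) (k : ℤ) :
    (k • X).HasParity i := by
  change (k • X).toEnd ∈ superDer 𝒜 i
  rw [map_zsmul]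
  exact zsmul_mem (S := Submodule ℝ (Module.End ℝ A)) hX k

theorem rightMul_zero_left (f : A) : rightMul (0 : SuperDer 𝒜) f = 0 := by
  simpa using rightMul_add_left (0 : SuperDer 𝒜) 0 f

theorem rightMul_zero_right (X : SuperDer 𝒜) : rightMul X 0 = 0 := by
  simpa using rightMul_add_right X 0 0

theorem rightMul_sum_left {ι : Type*} (s : Finset ι) (X : ι → SuperDer 𝒜) (f : A) :
    rightMul (∑ i ∈ s, X i) f = ∑ i ∈ s, rightMul (X i) f :=
  map_sum (AddMonoidHom.mk' (fun X : SuperDer 𝒜 => rightMul X f)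
    fun X Y => rightMul_add_left X Y f) X s

theorem rightMul_sum_right {ι : Type*} (s : Finset ι) (X : SuperDer 𝒜) (f : ι → A) :
    rightMul X (∑ i ∈ s, f i) = ∑ i ∈ s, rightMul X (f i) :=
  map_sum (AddMonoidHom.mk' (fun f : A => rightMul X f) fun f h => rightMul_add_right X f h) f s

theorem rightMul_smul (h : A) (X : SuperDer 𝒜) (f : A) :
    rightMul (h • X) f = h • rightMul X f := by
  have key : ∀ i j k, rightMul (GradedAlgebra.proj 𝒜 i h • part k X) (GradedAlgebra.proj 𝒜 j f) =
      GradedAlgebra.proj 𝒜 i h • rightMul (part k X) (GradedAlgebra.proj 𝒜 j f) := by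
    intro i j k
    have hi := proj_mem (𝒜 := 𝒜) i h
    have hj := proj_mem (𝒜 := 𝒜) j f
    rw [rightMul_of_hasParity (HasParity.smul hi (hasParity_part X k)) hj,
      rightMul_of_hasParity (hasParity_part X k) hj, smul_comm (GradedAlgebra.proj 𝒜 i h),
      smul_smul (GradedAlgebra.proj 𝒜 i h), SuperCommutative.comm hi hj, smul_assoc, smul_smul,
      smul_smul]
    congr 1
    exact (by decide : ∀ i j k : ZMod 2,
      paritySign ((i + k) * j) = paritySign (k * j) * paritySign (i * j)) i j k
  calc rightMul (h • X) f
      = ∑ i, ∑ k, ∑ j, rightMul (GradedAlgebra.proj 𝒜 i h • part k X)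
          (GradedAlgebra.proj 𝒜 j f) := by
        conv_lhs => rw [← sum_proj (𝒜 := 𝒜) h, ← sum_proj (𝒜 := 𝒜) f, ← sum_part X]
        simp_rw [Finset.sum_smul, Finset.smul_sum, rightMul_sum_left, rightMul_sum_right]
    _ = ∑ i, GradedAlgebra.proj 𝒜 i h • rightMul X f := by
        refine Finset.sum_congr rfl fun i _ => ?_
        conv_rhs => rw [← sum_proj (𝒜 := 𝒜) f, ← sum_part X]
        simp_rw [rightMul_sum_left, rightMul_sum_right, Finset.smul_sum, key]
    _ = h • rightMul X f := by rw [← Finset.sum_smul, sum_proj]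

theorem rightMul_mul {X : SuperDer 𝒜} {i j : ZMod 2} {f : A} (hX : X.HasParity i) (hf : f ∈ 𝒜 j)
    (h : A) : rightMul X (f * h) = paritySign (i * j) • (f • rightMul X h) := by
  rw [← sum_proj (𝒜 := 𝒜) h]
  simp only [Finset.mul_sum, rightMul_sum_right, Finset.smul_sum]
  refine Finset.sum_congr rfl fun k _ => ?_
  have hk := proj_mem (𝒜 := 𝒜) k h
  rw [rightMul_of_hasParity hX (SetLike.mul_mem_graded hf hk), rightMul_of_hasParity hX hk,
    smul_comm f, smul_smul, smul_smul]
  congr 1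
  exact (by decide : ∀ i j k : ZMod 2,
    paritySign (i * (j + k)) = paritySign (i * j) * paritySign (i * k)) i j k

end SuperDer

variable (𝒜)

/-- An affine connection on the vector fields `Der(A)`. -/
structure AffineConnection where
  toFun : SuperDer 𝒜 → SuperDer 𝒜 → SuperDer 𝒜
  hasParity : ∀ {i j : ZMod 2} {X Y : SuperDer 𝒜}, X.HasParity i → Y.HasParity j →
    (toFun X Y).HasParity (i + j)
  add_left : ∀ X Y Z, toFun (X + Y) Z = toFun X Z + toFun Y Z
  add_right : ∀ X Y Z, toFun X (Y + Z) = toFun X Y + toFun X Z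
  smul_left : ∀ (f : A) X Y, toFun (f • X) Y = f • toFun X Y
  leibniz : ∀ {i j : ZMod 2} {X : SuperDer 𝒜} {f : A}, X.HasParity i → f ∈ 𝒜 j →
    ∀ Y, toFun X (f • Y) =
      X.toEnd f • Y + paritySign (i * j) • (f • toFun X Y)

instance : CoeFun (AffineConnection 𝒜) fun _ => SuperDer 𝒜 → SuperDer 𝒜 → SuperDer 𝒜 :=
  ⟨AffineConnection.toFun⟩

/-- A homogeneous, graded symmetric, non-degenerate `A`-bilinear pairing of degree `d`
on `Der(A)`. -/
structure SuperMetric (d : ZMod 2) where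
  toFun : SuperDer 𝒜 → SuperDer 𝒜 → A
  degree : ∀ {i j : ZMod 2} {X Y : SuperDer 𝒜}, X.HasParity i → Y.HasParity j →
    toFun X Y ∈ 𝒜 (i + j + d)
  add_left : ∀ X Y Z, toFun (X + Y) Z = toFun X Z + toFun Y Z
  add_right : ∀ X Y Z, toFun X (Y + Z) = toFun X Y + toFun X Z
  smul_left : ∀ (f : A) X Y, toFun (f • X) Y = f * toFun X Y
  symm : ∀ {i j : ZMod 2} {X Y : SuperDer 𝒜}, X.HasParity i → Y.HasParity j →
    toFun X Y = paritySign (i * j) • toFun Y X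
  nondegenerate : ∀ X, (∀ Y, toFun X Y = 0) → X = 0

instance (d : ZMod 2) : CoeFun (SuperMetric 𝒜 d) fun _ => SuperDer 𝒜 → SuperDer 𝒜 → A :=
  ⟨SuperMetric.toFun⟩

variable {𝒜}

namespace AffineConnection

/-- `T(X, Y) = ∇_X Y - (-1)^{|X||Y|} ∇_Y X - [X, Y]` for homogeneous `X`, `Y`,
extended biadditively. -/
def torsion (D : AffineConnection 𝒜) (X Y : SuperDer 𝒜) : SuperDer 𝒜 :=
  ∑ i : ZMod 2, ∑ j : ZMod 2, (D (X.part i) (Y.part j) -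
    paritySign (i * j) • D (Y.part j) (X.part i) - (X.part i).bracket (Y.part j))

/-- `R(X, Y)Z = ∇_X ∇_Y Z - (-1)^{|X||Y|} ∇_Y ∇_X Z - ∇_{[X, Y]} Z` for homogeneous `X`, `Y`,
extended biadditively. -/
def curvature (D : AffineConnection 𝒜) (X Y Z : SuperDer 𝒜) : SuperDer 𝒜 :=
  ∑ i : ZMod 2, ∑ j : ZMod 2, (D (X.part i) (D (Y.part j) Z) -
    paritySign (i * j) • D (Y.part j) (D (X.part i) Z) - D ((X.part i).bracket (Y.part j)) Z)

/-- `X⟨Y, Z⟩ = ⟨∇_X Y, Z⟩ + (-1)^{|X||Y|} ⟨Y, ∇_X Z⟩`. -/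
def MetricCompatible (D : AffineConnection 𝒜) {d : ZMod 2} (g : SuperMetric 𝒜 d) : Prop :=
  ∀ {i j : ZMod 2} {X Y : SuperDer 𝒜}, X.HasParity i → Y.HasParity j → ∀ Z,
    X.toEnd (g Y Z) = g (D X Y) Z + paritySign (i * j) • g Y (D X Z)

/-- The Levi-Civita connection: symmetric (torsionless) and metric compatible. -/
structure IsLeviCivita (D : AffineConnection 𝒜) {d : ZMod 2} (g : SuperMetric 𝒜 d) : Prop where
  torsion_eq_zero : ∀ X Y, D.torsion X Y = 0
  metricCompatible : D.MetricCompatible g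

end AffineConnection

/-- The one-form `π(Z) = g(Z, P)`. -/
def SuperMetric.oneForm {d : ZMod 2} (g : SuperMetric 𝒜 d) (P : SuperDer 𝒜) :
    SuperDer 𝒜 →ₗ[A] A where
  toFun Z := g Z P
  map_add' X Y := g.add_left X Y P
  map_smul' f X := g.smul_left f X P

theorem SuperMetric.oneForm_mem {d p : ZMod 2} (g : SuperMetric 𝒜 d) {P : SuperDer 𝒜}
    (hP : P.HasParity p) (hdp : d + p = 0) {i : ZMod 2} {X : SuperDer 𝒜} (hX : X.HasParity i) :
    g X P ∈ 𝒜 i := by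
  have h := g.degree hX hP
  rwa [add_assoc, add_comm p d, hdp, add_zero] at h

/-- The semi-symmetric non-metric connection `∇̂_X Y = ∇_X Y + X · g(Y, P)`, which is
`∇_X Y + (-1)^{|X||Y|} g(Y, P) X` for homogeneous `X`, `Y`; here `|g| + |P| = 0`. -/
def semiSymmetricNonMetric (D : AffineConnection 𝒜) {d p : ZMod 2} (g : SuperMetric 𝒜 d)
    (P : SuperDer 𝒜) (hP : P.HasParity p) (hdp : d + p = 0) : AffineConnection 𝒜 where
  toFun X Y := D X Y + X.rightMul (g Y P)
  hasParity := by
    intro i j X Y hX hY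
    refine (D.hasParity hX hY).add ?_
    have hg := g.oneForm_mem hP hdp hY
    rw [SuperDer.rightMul_of_hasParity hX hg, add_comm i j]
    exact (SuperDer.HasParity.smul hg hX).zsmul _
  add_left X Y Z := by
    rw [D.add_left, SuperDer.rightMul_add_left]; abel
  add_right X Y Z := by
    rw [D.add_right, g.add_left, SuperDer.rightMul_add_right]; abel
  smul_left f X Y := by
    rw [D.smul_left, smul_add, SuperDer.rightMul_smul]
  leibniz := by
    intro i j X f hX hf Y
    rw [D.leibniz hX hf, smul_add, smul_add, g.smul_left, add_assoc,
      SuperDer.rightMul_mul hX hf]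

end Superalgebra

/-! ### Supermanifolds -/

/-- `C^∞(W)` for an open subset `W` of `ℝ^m`. -/
abbrev SmoothFun {m : ℕ} (W : Opens (EuclideanSpace ℝ (Fin m))) : Type :=
  C^∞⟮𝓘(ℝ, EuclideanSpace ℝ (Fin m)), W; 𝓘(ℝ, ℝ), ℝ⟯

/-- Restriction of smooth functions. -/
def SmoothFun.restrict {m : ℕ} {V W : Opens (EuclideanSpace ℝ (Fin m))} (h : V ≤ W) :
    SmoothFun W →ₐ[ℝ] SmoothFun V :=
  { ContMDiffMap.restrictRingHom 𝓘(ℝ, EuclideanSpace ℝ (Fin m)) 𝓘(ℝ, ℝ) ℝ h with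
    commutes' := fun _ => rfl }

/-- Sections `C^∞(W) ⊗ ⋀ ℝ^n` of the structure sheaf of the standard superdomain `W^{m|n}`. -/
abbrev SuperdomainFun {m : ℕ} (n : ℕ) (W : Opens (EuclideanSpace ℝ (Fin m))) : Type :=
  SmoothFun W ⊗[ℝ] ExteriorAlgebra ℝ (Fin n → ℝ)

/-- Restriction maps of the standard superdomain. -/
def SuperdomainFun.restrict {m : ℕ} (n : ℕ) {V W : Opens (EuclideanSpace ℝ (Fin m))} (h : V ≤ W) :
    SuperdomainFun n W →ₐ[ℝ] SuperdomainFun n V :=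
  Algebra.TensorProduct.map (SmoothFun.restrict h) (AlgHom.id ℝ _)

/-- The part of parity `i` of `C^∞(W) ⊗ ⋀ ℝ^n`, namely `C^∞(W) ⊗ (⋀ ℝ^n)_i`. (The exterior
algebra is the Clifford algebra of the zero form, and `evenOdd` is its `ℤ/2`-grading.) -/
def SuperdomainFun.grading {m : ℕ} (n : ℕ) (W : Opens (EuclideanSpace ℝ (Fin m))) (i : ZMod 2) :
    Submodule ℝ (SuperdomainFun n W) :=
  LinearMap.range (LinearMap.lTensor (SmoothFun W)
    (CliffordAlgebra.evenOdd (0 : QuadraticForm ℝ (Fin n → ℝ)) i).subtype)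

universe u

/-- A locally `ℤ/2`-ringed space: a second countable Hausdorff space with a sheaf of
supercommutative real algebras whose stalks are local rings. -/
structure LocallySuperRingedSpace where
  carrier : TopCat.{u}
  t2 : T2Space carrier
  secondCountable : SecondCountableTopology carrier
  sheaf : TopCat.Sheaf (AlgCat.{u} ℝ) carrier
  /-- The homogeneous sections over `U`. -/
  grading : ∀ U : Opens carrier, ZMod 2 → Submodule ℝ (sheaf.presheaf.obj (op U))
  gradedAlgebra : ∀ U, GradedAlgebra (grading U)
  superCommutative : ∀ U, SuperCommutative (grading U)
  map_mem_grading : ∀ {U V : Opens carrier} (h : V ≤ U) (i : ZMod 2),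
    ∀ s ∈ grading U i, (sheaf.presheaf.map (homOfLE h).op).hom s ∈ grading V i
  isLocalRing_stalk : ∀ p : carrier, IsLocalRing
    (TopCat.Presheaf.stalk (C := RingCat.{u}) (sheaf.presheaf ⋙ forget₂ (AlgCat.{u} ℝ) RingCat.{u}) p)

namespace LocallySuperRingedSpace

variable (S : LocallySuperRingedSpace.{u})

/-- The algebra `𝒪(U)` of sections over `U`. -/
abbrev Fun (U : Opens S.carrier) : Type u := S.sheaf.presheaf.obj (op U)

instance (U : Opens S.carrier) : GradedAlgebra (S.grading U) := S.gradedAlgebra U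

instance (U : Opens S.carrier) : SuperCommutative (S.grading U) := S.superCommutative U

/-- Restriction of sections. -/
def res {U V : Opens S.carrier} (h : V ≤ U) : S.Fun U →ₐ[ℝ] S.Fun V :=
  (S.sheaf.presheaf.map (homOfLE h).op).hom

/-- Sections over `U` of the tangent sheaf, `Der(𝒪(U))`. -/
abbrev Vect (U : Opens S.carrier) : Type u := SuperDer (S.grading U)

/-- The vector field `X'` on `V` is the restriction of the vector field `X` on `U`. -/
def IsRestriction {U V : Opens S.carrier} (h : V ≤ U) (X : S.Vect U) (X' : S.Vect V) : Prop :=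
  ∀ f : S.Fun U, S.res h (X.toEnd f) =
    X'.toEnd (S.res h f)

/-- An isomorphism of an open subspace of `S` with an open subspace of the standard superdomain
`ℝ^{m|n}`: a homeomorphism `toHomeo` of open subsets of the underlying spaces, with isomorphisms
of superalgebras between sections over corresponding open sets which commute with restrictions. -/
structure Chart (m n : ℕ) where
  toHomeo : OpenPartialHomeomorph S.carrier (EuclideanSpace ℝ (Fin m))
  iso : ∀ W : Opens (EuclideanSpace ℝ (Fin m)), (W : Set _) ⊆ toHomeo.target →
    S.Fun ⟨toHomeo.source ∩ toHomeo ⁻¹' W, toHomeo.isOpen_inter_preimage W.isOpen⟩ ≃ₐ[ℝ]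
      SuperdomainFun n W
  iso_mem_grading : ∀ W hW i f, f ∈ S.grading _ i → iso W hW f ∈ SuperdomainFun.grading n W i
  iso_res : ∀ V W hV hW (h : V ≤ W) f,
    iso V hV (S.res (Set.inter_subset_inter_right _ (Set.preimage_mono h)) f) =
      SuperdomainFun.restrict n h (iso W hW f)

end LocallySuperRingedSpace

/-- A supermanifold of dimension `m|n`. -/
structure Supermanifold (m n : ℕ) extends LocallySuperRingedSpace.{u} where
  exists_chart : ∀ p : carrier, ∃ c : toLocallySuperRingedSpace.Chart m n, p ∈ c.toHomeo.source

/-- A (homogeneous) Riemannian metric on a supermanifold, that is, a morphism of sheaves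
`𝒯M ⊗ 𝒯M → 𝒪_M` given by pairings on sections over open sets, compatible with restrictions. -/
structure SuperRiemannianMetric {m n : ℕ} (M : Supermanifold.{u} m n) where
  /-- The parity `|g|`. -/
  parity : ZMod 2
  onOpen : ∀ U : Opens M.carrier, SuperMetric (M.grading U) parity
  restrict : ∀ {U V : Opens M.carrier} (h : V ≤ U) (X Y : M.Vect U) (X' Y' : M.Vect V),
    M.IsRestriction h X X' → M.IsRestriction h Y Y' →
      M.res h (onOpen U X Y) = onOpen V X' Y'

/-- The metric on global vector fields. -/
abbrev SuperRiemannianMetric.globally {m n : ℕ} {M : Supermanifold.{u} m n}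
    (g : SuperRiemannianMetric M) : SuperMetric (M.grading ⊤) g.parity := g.onOpen ⊤

end

section SemiSymmetricNonMetric

variable {A : Type*} [Ring A] [Algebra ℝ A] {𝒜 : ZMod 2 → Submodule ℝ A} [GradedAlgebra 𝒜]
  [SuperCommutative 𝒜]

/-! ### Torsion and curvature evaluated on homogeneous vector fields. -/

namespace AffineConnection

/-! The identity is a computation with global sections, valid over any supercommutative algebra.
Because |g| + |P| = 0, the form π is even, so moving π(Y) past X costs exactly the sign
(-1)^{|X||Y|}.

In the second derivative of Z by X and Y, the Leibniz rule produces X(π(Z))Y, and metric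
compatibility splits X(π(Z)) into π(∇^L_X Z) and ± g(Z, ∇^L_X P)
(`semiSymmetricNonMetric_apply_apply`). After graded antisymmetrization in X and Y, the terms
containing π(∇^L_X Z) and π(∇^L_Y Z) cancel. The terms π(Z)∇^L_X Y and π(Z)∇^L_Y X combine, since
∇^L is torsion-free, into π(Z)[X,Y], which is removed by the correction term of the derivative along
[X,Y]. What survives is R^L, the terms in ∇^L P, and the terms quadratic in π.

Torsion and curvature are defined as sums over homogeneous components; `sum_part_part` reduces them
to the usual signed formulas. -/

theorem map_zero_left (D : AffineConnection 𝒜) (Y : SuperDer 𝒜) : D 0 Y = 0 := by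
  simpa using D.add_left 0 0 Y

theorem map_zero_right (D : AffineConnection 𝒜) (X : SuperDer 𝒜) : D X 0 = 0 := by
  simpa using D.add_right X 0 0

theorem map_zsmul_right (D : AffineConnection 𝒜) (X Y : SuperDer 𝒜) (k : ℤ) :
    D X (k • Y) = k • D X Y :=
  map_zsmul (AddMonoidHom.mk' (fun Y => D X Y) fun Y Z => D.add_right X Y Z) k Y

end AffineConnection

namespace SuperDer

theorem bracket_zero_left (Y : SuperDer 𝒜) : bracket 0 Y = 0 := by
  have h (i : ZMod 2) : (part i (0 : SuperDer 𝒜)).toEnd = 0 := map_zero (homPart 𝒜 i)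
  refine Finset.sum_eq_zero fun i _ => Finset.sum_eq_zero fun j _ => Subtype.ext ?_
  simp only [h, zero_mul, mul_zero, smul_zero, sub_zero]
  rfl

theorem bracket_zero_right (X : SuperDer 𝒜) : bracket X 0 = 0 := by
  have h (i : ZMod 2) : (part i (0 : SuperDer 𝒜)).toEnd = 0 := map_zero (homPart 𝒜 i)
  refine Finset.sum_eq_zero fun i _ => Finset.sum_eq_zero fun j _ => Subtype.ext ?_
  simp only [h, zero_mul, mul_zero, smul_zero, sub_zero]
  rfl

/-- A double sum over homogeneous components, evaluated at homogeneous vector fields. -/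
theorem sum_part_part {B : Type*} [AddCommMonoid B] {x y : ZMod 2} {X Y : SuperDer 𝒜}
    (hX : X.HasParity x) (hY : Y.HasParity y)
    (F : ZMod 2 → ZMod 2 → SuperDer 𝒜 → SuperDer 𝒜 → B)
    (h₁ : ∀ i j V, F i j 0 V = 0) (h₂ : ∀ i j U, F i j U 0 = 0) :
    ∑ i, ∑ j, F i j (X.part i) (Y.part j) = F x y X Y := by
  -- A homogeneous field has at most one nonzero component, so vanishing of `F` at zero arguments is
  -- all that is needed in place of biadditivity.
  rw [Finset.sum_eq_single x, Finset.sum_eq_single y]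
  · rw [part_of_hasParity hX, part_of_hasParity hY, if_pos rfl, if_pos rfl]
  · intro j _ hj
    rw [part_of_hasParity hY, if_neg hj.symm, h₂]
  · exact fun h => absurd (Finset.mem_univ _) h
  · intro i _ hi
    refine Finset.sum_eq_zero fun j _ => ?_
    rw [part_of_hasParity hX, if_neg hi.symm, h₁]
  · exact fun h => absurd (Finset.mem_univ _) h

end SuperDer

namespace AffineConnection

variable {x y : ZMod 2} {X Y : SuperDer 𝒜}

theorem torsion_of_hasParity (D : AffineConnection 𝒜) (hX : X.HasParity x) (hY : Y.HasParity y) :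
    D.torsion X Y = D X Y - paritySign (x * y) • D Y X - X.bracket Y :=
  SuperDer.sum_part_part hX hY
    (fun i j U V => D U V - paritySign (i * j) • D V U - U.bracket V)
    (fun i j V => by
      simp only [map_zero_left, map_zero_right, SuperDer.bracket_zero_left, smul_zero, sub_zero])
    (fun i j U => by
      simp only [map_zero_left, map_zero_right, SuperDer.bracket_zero_right, smul_zero, sub_zero])

theorem curvature_of_hasParity (D : AffineConnection 𝒜) (hX : X.HasParity x)
    (hY : Y.HasParity y) (Z : SuperDer 𝒜) :
    D.curvature X Y Z =
      D X (D Y Z) - paritySign (x * y) • D Y (D X Z) - D (X.bracket Y) Z :=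
  SuperDer.sum_part_part hX hY
    (fun i j U V => D U (D V Z) - paritySign (i * j) • D V (D U Z) - D (U.bracket V) Z)
    (fun i j V => by
      simp only [map_zero_left, map_zero_right, SuperDer.bracket_zero_left, smul_zero, sub_zero])
    (fun i j U => by
      simp only [map_zero_left, map_zero_right, SuperDer.bracket_zero_right, smul_zero, sub_zero])

theorem bracket_eq_of_torsion_eq_zero (D : AffineConnection 𝒜) (hD : ∀ X Y, D.torsion X Y = 0)
    (hX : X.HasParity x) (hY : Y.HasParity y) :
    X.bracket Y = D X Y - paritySign (x * y) • D Y X :=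
  (sub_eq_zero.1 ((D.torsion_of_hasParity hX hY).symm.trans (hD X Y))).symm

/-- Both terms of the torsion-free expression for the bracket have parity x + y. This fixes the sign
in the correction term of the derivative along [X,Y]. -/
theorem bracket_hasParity_of_torsion_eq_zero (D : AffineConnection 𝒜)
    (hD : ∀ X Y, D.torsion X Y = 0) (hX : X.HasParity x) (hY : Y.HasParity y) :
    (X.bracket Y).HasParity (x + y) := by
  rw [D.bracket_eq_of_torsion_eq_zero hD hX hY, sub_eq_add_neg, ← neg_smul]
  have h := D.hasParity hY hX
  rw [add_comm] at h
  exact (D.hasParity hX hY).add (h.zsmul _)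

end AffineConnection

/-! ### Curvature of the semi-symmetric non-metric connection. -/

variable {d p x y z : ZMod 2} {g : SuperMetric 𝒜 d} {P X Y Z : SuperDer 𝒜}

theorem semiSymmetricNonMetric_apply (D : AffineConnection 𝒜) (hP : P.HasParity p)
    (hdp : d + p = 0) (hX : X.HasParity x) (hY : Y.HasParity y) :
    semiSymmetricNonMetric D g P hP hdp X Y =
      D X Y + paritySign (x * y) • (g Y P • X) := by
  change D X Y + X.rightMul (g Y P) = _
  rw [SuperDer.rightMul_of_hasParity hX (g.oneForm_mem hP hdp hY)]

/-- The second covariant derivative of the semi-symmetric non-metric connection of a metric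
connection. -/
theorem semiSymmetricNonMetric_apply_apply (D : AffineConnection 𝒜) (hD : D.MetricCompatible g)
    (hP : P.HasParity p) (hdp : d + p = 0) (hX : X.HasParity x) (hY : Y.HasParity y)
    (hZ : Z.HasParity z) :
    semiSymmetricNonMetric D g P hP hdp X (semiSymmetricNonMetric D g P hP hdp Y Z) =
      D X (D Y Z) + paritySign (x * (y + z)) • (g (D Y Z) P • X) +
        paritySign (y * z) • (g (D X Z) P • Y + paritySign (x * z) • (g Z (D X P) • Y) +
          paritySign (x * z) • (g Z P • D X Y + paritySign (x * y) • (g Z P • g Y P • X))) := by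
  -- The sign with exponent x(y + z) comes from the parity of ∇_Y Z. The Leibniz rule applies to
  -- π(Z)Y with π(Z) of parity z, and metric compatibility then expands X(π(Z)).
  rw [semiSymmetricNonMetric_apply D hP hdp hY hZ, AffineConnection.add_right,
    AffineConnection.map_zsmul_right,
    semiSymmetricNonMetric_apply D hP hdp hX (D.hasParity hY hZ),
    AffineConnection.leibniz _ hX (g.oneForm_mem hP hdp hZ),
    semiSymmetricNonMetric_apply D hP hdp hX hY, hD hX hZ P, add_smul, smul_assoc, smul_add (g Z P),
    smul_comm (g Z P) (paritySign (x * y))]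

theorem curvature_semiSymmetricNonMetric (D : AffineConnection 𝒜) (hD : D.IsLeviCivita g)
    (hP : P.HasParity p) (hdp : d + p = 0) (hX : X.HasParity x) (hY : Y.HasParity y)
    (hZ : Z.HasParity z) :
    (semiSymmetricNonMetric D g P hP hdp).curvature X Y Z =
      D.curvature X Y Z
      + paritySign ((x + y) * z) • (g Z (D X P) • Y - paritySign (x * y) • (g Z (D Y P) • X))
      + paritySign ((x + y) * z) •
        (g Z P • (paritySign (x * y) • (g Y P • X) - g X P • Y)) := by
  have hB := D.bracket_hasParity_of_torsion_eq_zero hD.torsion_eq_zero hX hY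
  rw [AffineConnection.curvature_of_hasParity _ hX hY, 
    AffineConnection.curvature_of_hasParity _ hX hY,
    semiSymmetricNonMetric_apply_apply D hD.metricCompatible hP hdp hX hY hZ,
    semiSymmetricNonMetric_apply_apply D hD.metricCompatible hP hdp hY hX hZ,
    semiSymmetricNonMetric_apply D hP hdp hB hZ]
  -- The bracket is expanded only where π(Z) multiplies it; the derivative of Z along [X,Y] belongs
  -- to `D.curvature` and must stay intact to match the other side.
  have hB' : g Z P • X.bracket Y = g Z P • D X Y - paritySign (x * y) • (g Z P • D Y X) := by
    rw [D.bracket_eq_of_torsion_eq_zero hD.torsion_eq_zero hX hY, smul_sub, smul_comm (g Z P)]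
  rw [hB', smul_sub (g Z P), smul_comm (g Z P) (paritySign (x * y))]
  have parity_cases : ∀ i : ZMod 2, i = 0 ∨ i = 1 := by decide
  have h1 : (1 + 1 : ZMod 2) = 0 := by decide
  have h2 : paritySign 0 = 1 := by decide
  have h3 : paritySign 1 = -1 := by decide
  -- In each of the eight parity cases every sign is ±1, leaving an identity in an additive group.
  -- The products π(Z)π(Y) and π(Z)π(X) occur in the same order on both sides, so no
  -- supercommutation is needed.
  rcases parity_cases x with rfl | rfl <;> rcases parity_cases y with rfl | rfl <;>
    rcases parity_cases z with rfl | rfl <;>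
    simp only [h1, h2, h3, mul_zero, mul_one, add_zero, zero_add, one_smul, neg_smul] <;>
    abel

end SemiSymmetricNonMetric

/-! ### The result on a supermanifold, from the algebra of global sections. -/

theorem proposition2p15 {m n : ℕ} (M : Supermanifold m n) (g : SuperRiemannianMetric M)
    -- the vector field `P`, with `|g| + |P| = 0`
    (p : ZMod 2) (P : M.Vect ⊤) (hP : P.HasParity p) (hgP : g.parity + p = 0)
    -- the Levi-Civita connection
    (nablaL : AffineConnection (M.grading ⊤)) (hL : nablaL.IsLeviCivita g.globally) :
    -- the one-form `π(Z) = g(Z, P)` is even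
    (∀ (z : ZMod 2) (Z : M.Vect ⊤), Z.HasParity z → g.globally.oneForm P Z ∈ M.grading ⊤ z) ∧
    -- the curvature of the semi-symmetric non-metric connection
    ∀ (x y z : ZMod 2) (X Y Z : M.Vect ⊤), X.HasParity x → Y.HasParity y → Z.HasParity z →
      (semiSymmetricNonMetric nablaL g.globally P hP hgP).curvature X Y Z =
        nablaL.curvature X Y Z
        + paritySign ((x + y) * z) • (g.globally Z (nablaL X P) • Y
            - paritySign (x * y) • (g.globally Z (nablaL Y P) • X))
        + paritySign ((x + y) * z) • (g.globally.oneForm P Z •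
            (paritySign (x * y) • (g.globally.oneForm P Y • X) - g.globally.oneForm P X • Y)) := by
  exact ⟨fun z Z hZ => g.globally.oneForm_mem hP hgP hZ,
    fun x y z X Y Z hX hY hZ => curvature_semiSymmetricNonMetric nablaL hL hP hgP hX hY hZ⟩
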